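/- Let $\Gamma$ be a connected compact metric graph with at least one edge: finitely many vertices and edges, no loops or multiple edges, each edge $\mathbf e$ having a finite length $\ell_{\mathbf e}>0$ and being identified with $[0,\ell_{\mathbf e}]$, where $0$ corresponds to its initial vertex $\mathrm i_{\mathbf e}$ and $\ell_{\mathbf e}$ to its terminal vertex $\mathrm f_{\mathbf e}$. A function $u$ on $\Gamma$ is a family of functions $[u]_{\mathbf e}$ on $(0,\ell_{\mathbf e})$, with $\int_\Gamma u=\sum_{\mathbf e}\int_0^{\ell_{\mathbf e}}[u]_{\mathbf e}\,dx$ and $\|u\|_1=\int_\Gamma|u|$; $\ell(D)$ is the sum over the edges of the Lebesgue measures of $D\cap\mathbf e$; and $u\in BV(\Gamma)$ (respectively $W^{1,2}(\Gamma)$) means $[u]_{\mathbf e}\in BV(0,\ell_{\mathbf e})$ (respectively $W^{1,2}(0,\ell_{\mathbf e})$) for every edge $\mathbf e$, with no continuity condition at the vertices. Let $X_K(\Gamma)$ be the set of $\mathbf z\in W^{1,2}(\Gamma)$ such that at every vertex $\mathbf v$ the Kirchhoff condition $$\sum_{\mathbf e:\ \mathrm f_{\mathbf e}=\mathbf v}[\mathbf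 z]_{\mathbf e}(\ell_{\mathbf e})-\sum_{\mathbf e:\ \mathrm i_{\mathbf e}=\mathbf v}[\mathbf z]_{\mathbf e}(0)=0$$ holds. For $u\in BV(\Gamma)$ put $$TV_\Gamma(u)=\sup\Big\{\Big|\int_\Gamma u\,\mathbf z'\Big| : \mathbf z\in X_K(\Gamma),\ \|\mathbf z\|_{L^\infty(\Gamma)}\le 1\Big\}.$$ A measurable set $D\subset\Gamma$ has finite perimeter if $\chi_D\in BV(\Gamma)$, and then $\mathrm{Per}_\Gamma(D)=TV_\Gamma(\chi_D)$. Define the $\Gamma$-Cheeger constant $$h(\Gamma)=\inf\Big\{\frac{\mathrm{Per}_\Gamma(D)}{\min\{\ell(D),\ell(\Gamma\setminus D)\}} : D\subset\Gamma \text{ of finite perimeter},\ 0<\ell(D)<\ell(\Gamma)\Big\},$$ and call $D$ (that is, the partition $(D,\Gamma\setminus D)$) a Cheeger cut of $\Gamma$ if $D$ has finite perimeter, $0<\ell(D)\le\frac12\ell(\Gamma)$ and $h(\Gamma)=\mathrm{Per}_\Gamma(D)/\ell(D)$. Let $\Pi(\Gamma)$ be the set of $u\in BV(\Gamma)$ with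 $\|u\|_1=1$ for which $0$ is a median, that is, $\ell(\{u<0\})\le\frac12\ell(\Gamma)$ and $\ell(\{u>0\})\le\frac12\ell(\Gamma)$, and let $$\lambda_1(\Gamma)=\inf\{TV_\Gamma(u) : u\in\Pi(\Gamma)\}.$$ Then $h(\Gamma)=\lambda_1(\Gamma)<\infty$. Moreover, there exist $u\in\Pi(\Gamma)$ with $TV_\Gamma(u)=\lambda_1(\Gamma)$ and $t\ge 0$ such that the superlevel set $E_t(u)=\{x\in\Gamma : u(x)>t\}$ is a Cheeger cut of $\Gamma$. In particular, Cheeger cuts exist. -/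

import Mathlib

open MeasureTheory Set
open scoped ENNReal ContDiff

noncomputable section

/-- A connected compact metric graph with vertices `V` and edges `E` (both taken finite below),
without loops and without multiple edges. Each edge `e` has an initial and a terminal vertex and a
finite positive length, and its points are identified with their coordinates in `[0, len e]`
(`0` at `init e`, `len e` at `term e`). -/
structure CompactMetricGraph (V E : Type*) where
  init : E → V
  term : E → V
  len : E → ℝ
  len_pos : ∀ e, 0 < len e
  no_loops : ∀ e, init e ≠ term e
  no_multiple_edges : Function.Injective fun e => s(init e, term e)
  connected : (SimpleGraph.fromEdgeSet (range fun e => s(init e, term e))).Connected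

/-- Test functions `C_c^∞(0, l)`. -/
def IsTestFunction (l : ℝ) (φ : ℝ → ℝ) : Prop :=
  ContDiff ℝ ∞ φ ∧ HasCompactSupport φ ∧ tsupport φ ⊆ Ioo 0 l

/-- `w` is the weak (distributional) derivative of `z` on `(0, l)`. -/
def HasWeakDeriv (l : ℝ) (z w : ℝ → ℝ) : Prop :=
  ∀ φ : ℝ → ℝ, IsTestFunction l φ →
    ∫ x in Ioo 0 l, z x * deriv φ x = -∫ x in Ioo 0 l, w x * φ x

/-- `z ∈ W^{1,2}(0, l)` with weak derivative `w`, where `z` is the representative that is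
continuous on `[0, l]`; `z 0` and `z l` are then its boundary values. -/
structure IsSobolev (l : ℝ) (z w : ℝ → ℝ) : Prop where
  memLp : MemLp z 2 (volume.restrict (Ioo 0 l))
  memLp_deriv : MemLp w 2 (volume.restrict (Ioo 0 l))
  weakDeriv : HasWeakDeriv l z w
  continuousOn : ContinuousOn z (Icc 0 l)

/-- `u ∈ BV(0, l)`: `u` is integrable on `(0, l)` and its distributional derivative is a signed
measure `μ - ν` of finite total variation. -/
def IsBV (l : ℝ) (u : ℝ → ℝ) : Prop :=
  IntegrableOn u (Ioo 0 l) ∧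
    ∃ μ ν : Measure ℝ, IsFiniteMeasure μ ∧ IsFiniteMeasure ν ∧
      ∀ φ : ℝ → ℝ, IsTestFunction l φ →
        ∫ x in Ioo 0 l, u x * deriv φ x = -(∫ x, φ x ∂μ - ∫ x, φ x ∂ν)

namespace CompactMetricGraph

variable {V E : Type*} [Fintype E] (Γ : CompactMetricGraph V E)

/- A function on the graph is a family `u : E → ℝ → ℝ` of functions on the edges, of which only
the values `u e x` with `x ∈ (0, len e)` matter. A subset of the graph is a family `D : E → Set ℝ`
with `D e ⊆ (0, len e)`; the finitely many vertices, which have length zero, are left out. -/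

open Classical in
/-- The edges incident to the vertex `v`. -/
def incidentEdges (v : V) : Finset E :=
  Finset.univ.filter fun e => Γ.init e = v ∨ Γ.term e = v

open Classical in
/-- The outward boundary value at `v` of a vector field `z` on an edge `e` incident to `v`. -/
def outwardValue (z : E → ℝ → ℝ) (e : E) (v : V) : ℝ :=
  if Γ.term e = v then z e (Γ.len e) else -z e 0

/-- `z ∈ X_K(Γ)` with (edgewise weak) derivative `w`: `z ∈ W^{1,2}(Γ)` and `z` satisfies the
Kirchhoff condition at every vertex. -/
structure IsKirchhoff (z w : E → ℝ → ℝ) : Prop where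
  sobolev : ∀ e, IsSobolev (Γ.len e) (z e) (w e)
  kirchhoff : ∀ v, ∑ e ∈ Γ.incidentEdges v, Γ.outwardValue z e v = 0

/-- `u ∈ BV(Γ)`. -/
def MemBV (u : E → ℝ → ℝ) : Prop := ∀ e, IsBV (Γ.len e) (u e)

/-- The integral over the graph. -/
def integral (u : E → ℝ → ℝ) : ℝ := ∑ e, ∫ x in Ioo 0 (Γ.len e), u e x

/-- The total variation `TV_Γ(u)`, the supremum of `|∫_Γ u z'|` over all `z ∈ X_K(Γ)` with
`‖z‖_∞ ≤ 1`. -/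
def totalVariation (u : E → ℝ → ℝ) : ℝ≥0∞ :=
  ⨆ (z : E → ℝ → ℝ) (w : E → ℝ → ℝ) (_ : Γ.IsKirchhoff z w)
    (_ : ∀ e, eLpNorm (z e) ∞ (volume.restrict (Ioo 0 (Γ.len e))) ≤ 1),
    ENNReal.ofReal |Γ.integral fun e x => u e x * w e x|

/-- The characteristic function of a subset of the graph. -/
def char (D : E → Set ℝ) : E → ℝ → ℝ := fun e => (D e).indicator fun _ => 1

/-- The `Γ`-perimeter. -/
def perimeter (D : E → Set ℝ) : ℝ≥0∞ := Γ.totalVariation (char D)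

/-- `D` is a (Lebesgue) measurable subset of the graph of finite perimeter. -/
structure IsFinitePerimeter (D : E → Set ℝ) : Prop where
  subset : ∀ e, D e ⊆ Ioo 0 (Γ.len e)
  measurable : ∀ e, NullMeasurableSet (D e) volume
  memBV : Γ.MemBV (char D)

/-- The length of a subset of the graph. -/
def length (D : E → Set ℝ) : ℝ≥0∞ := ∑ e, volume (D e)

/-- The length `ℓ(Γ)` of the graph. -/
def totalLength : ℝ≥0∞ := ∑ e, ENNReal.ofReal (Γ.len e)

/-- The complement `Γ ∖ D`. -/
def compl (D : E → Set ℝ) : E → Set ℝ := fun e => Ioo 0 (Γ.len e) \ D e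

/-- The superlevel set `E_t(u) = {u > t}`. -/
def superlevel (u : E → ℝ → ℝ) (t : ℝ) : E → Set ℝ := fun e => {x ∈ Ioo 0 (Γ.len e) | t < u e x}

/-- The sublevel set `{u < t}`. -/
def sublevel (u : E → ℝ → ℝ) (t : ℝ) : E → Set ℝ := fun e => {x ∈ Ioo 0 (Γ.len e) | u e x < t}

/-- `m` is a median of `u` with respect to the length measure. -/
def IsMedian (u : E → ℝ → ℝ) (m : ℝ) : Prop :=
  length (Γ.sublevel u m) ≤ Γ.totalLength / 2 ∧ length (Γ.superlevel u m) ≤ Γ.totalLength / 2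

/-- The `Γ`-Cheeger constant `h(Γ)`. -/
def cheegerConstant : ℝ≥0∞ :=
  ⨅ (D : E → Set ℝ) (_ : Γ.IsFinitePerimeter D) (_ : 0 < length D)
    (_ : length D < Γ.totalLength),
    Γ.perimeter D / min (length D) (length (Γ.compl D))

/-- `(D, Γ ∖ D)` is a Cheeger cut of `Γ`. -/
structure IsCheegerCut (D : E → Set ℝ) : Prop where
  finitePerimeter : Γ.IsFinitePerimeter D
  length_pos : 0 < length D
  length_le : length D ≤ Γ.totalLength / 2
  eq : Γ.cheegerConstant = Γ.perimeter D / length D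

/-- The admissible class `Π(Γ)`. -/
structure Admissible (u : E → ℝ → ℝ) : Prop where
  memBV : Γ.MemBV u
  norm_eq_one : (Γ.integral fun e x => |u e x|) = 1
  median : Γ.IsMedian u 0

/-- `λ₁(Γ)`. -/
def lambdaOne : ℝ≥0∞ := ⨅ (u : E → ℝ → ℝ) (_ : Γ.Admissible u), Γ.totalVariation u

end CompactMetricGraph

end

/-!
An elementary cut is either a vertex set together with one point on every edge leaving it, or a
segment inside a single edge. By compactness some elementary cut minimises the ratio `c` of its
number of boundary points to the length of its smaller side; call the smaller side `D`, so that
`Per D / ℓ(D) ≤ c`. Conversely `c ≤ TV(u)` for every admissible `u`: as `0` is a median of `u`, its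
multivalued sign has a selection `s` with values in `[-1, 1]` and mean zero, and `c s` is the
derivative of a Kirchhoff field `z` with `|z| ≤ 1`, whence `TV(u) ≥ ∫ u c s = c ‖u‖₁ = c`. The
field `z` comes from Hoffman's circulation theorem: on the edge `e` it is an initial value `f e`
plus a primitive of `c s`, the bound `|z| ≤ 1` confines `f e` to an interval, nonempty by the
optimality of `c` among segments, and the Kirchhoff conditions on `f` are solvable by the optimality
of `c` among vertex cuts. Hence `λ₁ = Per D / ℓ(D)`, attained at the normalised characteristic
function of `D`, while `λ₁ ≤ h ≤ Per D / ℓ(D)`.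
-/

/-! ### Weak derivatives on an interval -/

theorem setIntegral_Ioo_eq_intervalIntegral {a b : ℝ} (hab : a ≤ b) (f : ℝ → ℝ) :
    ∫ x in Ioo a b, f x = ∫ x in a..b, f x := by
  rw [intervalIntegral.integral_of_le hab, integral_Ioc_eq_integral_Ioo]

theorem intervalIntegrable_of_mem_Icc {a b c d : ℝ} {w : ℝ → ℝ} (hw : IntegrableOn w (Ioo c d))
    (ha : a ∈ Icc c d) (hb : b ∈ Icc c d) : IntervalIntegrable w volume a b :=
  intervalIntegrable_iff.2 <| IntegrableOn.mono_set
    (by rwa [integrableOn_Icc_iff_integrableOn_Ioo]) <|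
    uIoc_subset_uIcc.trans (uIcc_subset_Icc ha hb)

theorem integrableOn_Ioo_mul_continuous {a b : ℝ} {f g : ℝ → ℝ} (hf : IntegrableOn f (Ioo a b))
    (hg : Continuous g) : IntegrableOn (fun x => f x * g x) (Ioo a b) := by
  rw [← integrableOn_Icc_iff_integrableOn_Ioo] at hf ⊢
  exact hf.mul_continuousOn hg.continuousOn isCompact_Icc

theorem continuousOn_primitive_Icc {l : ℝ} {w : ℝ → ℝ} (hw : IntegrableOn w (Ioo 0 l)) :
    ContinuousOn (fun x => ∫ t in (0 : ℝ)..x, w t) (Icc 0 l) := by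
  rcases lt_or_ge l 0 with hl | hl
  · simp [Icc_eq_empty_of_lt hl]
  · simpa only [uIcc_of_le hl] using intervalIntegral.continuousOn_primitive_interval'
      (intervalIntegrable_of_mem_Icc hw ⟨le_rfl, hl⟩ ⟨hl, le_rfl⟩) left_mem_uIcc

namespace IsTestFunction

variable {l : ℝ} {φ : ℝ → ℝ}

theorem continuous_deriv (hφ : IsTestFunction l φ) : Continuous (deriv φ) :=
  hφ.1.continuous_deriv (by simp)

theorem eq_zero_of_notMem (hφ : IsTestFunction l φ) {x : ℝ} (hx : x ∉ Ioo 0 l) : φ x = 0 :=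
  image_eq_zero_of_notMem_tsupport fun h => hx (hφ.2.2 h)

theorem intervalIntegral_deriv (hφ : IsTestFunction l φ) (a b : ℝ) :
    ∫ x in a..b, deriv φ x = φ b - φ a :=
  intervalIntegral.integral_deriv_eq_sub (fun x _ => hφ.1.differentiable (by simp) x)
    (hφ.continuous_deriv.intervalIntegrable _ _)

theorem setIntegral_deriv (hφ : IsTestFunction l φ) : ∫ x in Ioo 0 l, deriv φ x = 0 := by
  rcases lt_or_ge l 0 with hl | hl
  · simp [Ioo_eq_empty_of_le hl.le]
  · rw [setIntegral_Ioo_eq_intervalIntegral hl, hφ.intervalIntegral_deriv,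
      hφ.eq_zero_of_notMem (by simp), hφ.eq_zero_of_notMem (by simp), sub_zero]

theorem setIntegral_mul (hφ : IsTestFunction l φ) (f : ℝ → ℝ) :
    ∫ x in Ioo 0 l, f x * φ x = ∫ x, f x * φ x :=
  setIntegral_eq_integral_of_forall_compl_eq_zero fun x hx => by
    rw [hφ.eq_zero_of_notMem hx, mul_zero]

theorem sub_const_mul {ψ : ℝ → ℝ} (hφ : IsTestFunction l φ) (hψ : IsTestFunction l ψ) (c : ℝ) :
    IsTestFunction l fun x => φ x - c * ψ x :=
  ⟨hφ.1.sub (contDiff_const.mul hψ.1), hφ.2.1.sub hψ.2.1.mul_left, (tsupport_sub _ _).trans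
    (union_subset hφ.2.2 (tsupport_mul_subset_right.trans hψ.2.2))⟩

theorem exists_tsupport_subset_Icc (hφ : IsTestFunction l φ) :
    ∃ a b, 0 < a ∧ b < l ∧ tsupport φ ⊆ Icc a b := by
  rcases (tsupport φ).eq_empty_or_nonempty with h | h
  · exact ⟨1, l - 1, one_pos, by linarith, by simp [h]⟩
  · have hK : IsCompact (tsupport φ) := hφ.2.1
    obtain ⟨a, ha⟩ := hK.exists_isLeast h
    obtain ⟨b, hb⟩ := hK.exists_isGreatest h
    exact ⟨a, b, (hφ.2.2 ha.1).1, (hφ.2.2 hb.1).2, fun x hx => ⟨ha.2 hx, hb.2 hx⟩⟩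

theorem primitive (hφ : IsTestFunction l φ) (hmean : ∫ x in (0 : ℝ)..l, φ x = 0) :
    IsTestFunction l fun x => ∫ t in (0 : ℝ)..x, φ t := by
  have hcont : Continuous φ := hφ.1.continuous
  have hsmooth : ContDiff ℝ ∞ fun x => ∫ t in (0 : ℝ)..x, φ t := by
    rw [contDiff_infty_iff_deriv, funext (hcont.deriv_integral φ 0)]
    exact ⟨fun x => (hcont.integral_hasStrictDerivAt 0 x).hasDerivAt.differentiableAt, hφ.1⟩
  obtain ⟨a, b, ha, hb, hab⟩ := hφ.exists_tsupport_subset_Icc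
  have hzero {c d : ℝ} (hcd : ∀ t ∈ uIcc c d, t ∉ Icc a b) : ∫ t in c..d, φ t = 0 :=
    (intervalIntegral.integral_congr fun t ht =>
      image_eq_zero_of_notMem_tsupport fun h => hcd t ht (hab h)).trans
      intervalIntegral.integral_zero
  have hsupp : tsupport (fun x => ∫ t in (0 : ℝ)..x, φ t) ⊆ Icc a b := by
    refine closure_minimal (fun x hx => ?_) isClosed_Icc
    by_contra hxab
    refine hx ?_
    rcases lt_or_ge x a with hxa | hax
    · exact hzero fun t ht hta => (hta.1.trans ht.2).not_gt (max_lt ha hxa)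
    · have hbx : b < x := lt_of_not_ge fun hxb => hxab ⟨hax, hxb⟩
      change ∫ t in (0 : ℝ)..x, φ t = 0
      rw [← intervalIntegral.integral_add_adjacent_intervals (b := l)
        (hcont.intervalIntegrable _ _) (hcont.intervalIntegrable _ _), hmean, zero_add]
      exact hzero fun t ht htb => (ht.1.trans htb.2).not_gt (lt_min hb hbx)
  exact ⟨hsmooth, HasCompactSupport.of_support_subset_isCompact isCompact_Icc
    ((subset_tsupport _).trans hsupp), hsupp.trans (Icc_subset_Ioo ha hb)⟩

end IsTestFunction

theorem exists_isTestFunction_integral_eq_one {l : ℝ} (hl : 0 < l) :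
    ∃ η, IsTestFunction l η ∧ ∫ x, η x = 1 := by
  let f : ContDiffBump (l / 2) := ⟨l / 8, l / 4, by positivity, by linarith⟩
  refine ⟨f.normed volume, ⟨f.contDiff_normed, f.hasCompactSupport_normed, ?_⟩,
    f.integral_normed⟩
  rw [f.tsupport_normed_eq, Real.closedBall_eq_Icc]
  exact Icc_subset_Ioo (show 0 < l / 2 - l / 4 by linarith) (show l / 2 + l / 4 < l by linarith)

theorem HasWeakDeriv.sub {l : ℝ} {z₁ z₂ w₁ w₂ : ℝ → ℝ} (h₁ : HasWeakDeriv l z₁ w₁)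
    (h₂ : HasWeakDeriv l z₂ w₂) (hz₁ : IntegrableOn z₁ (Ioo 0 l)) (hz₂ : IntegrableOn z₂ (Ioo 0 l))
    (hw₁ : IntegrableOn w₁ (Ioo 0 l)) (hw₂ : IntegrableOn w₂ (Ioo 0 l)) :
    HasWeakDeriv l (z₁ - z₂) (w₁ - w₂) := by
  intro φ hφ
  have hφc := hφ.1.continuous
  simp only [Pi.sub_apply, sub_mul]
  rw [integral_sub (integrableOn_Ioo_mul_continuous hz₁ hφ.continuous_deriv)
      (integrableOn_Ioo_mul_continuous hz₂ hφ.continuous_deriv),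
    integral_sub (integrableOn_Ioo_mul_continuous hw₁ hφc)
      (integrableOn_Ioo_mul_continuous hw₂ hφc), h₁ φ hφ, h₂ φ hφ]
  ring

theorem hasWeakDeriv_primitive {l : ℝ} (hl : 0 ≤ l) {w : ℝ → ℝ} (hw : IntegrableOn w (Ioo 0 l))
    (c : ℝ) : HasWeakDeriv l (fun x => c + ∫ t in (0 : ℝ)..x, w t) w := by
  intro φ hφ
  have hi : IntervalIntegrable w volume 0 l :=
    intervalIntegrable_of_mem_Icc hw ⟨le_rfl, hl⟩ ⟨hl, le_rfl⟩
  have hac := hi.absolutelyContinuousOnInterval_intervalIntegral (c := 0) (by simp)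
  have hφac : AbsolutelyContinuousOnInterval φ 0 l :=
    (hφ.1.contDiffOn.of_le (by simp)).absolutelyContinuousOnInterval
  have hderiv : ∫ x in (0 : ℝ)..l, deriv (fun x => ∫ t in (0 : ℝ)..x, w t) x * φ x =
      ∫ x in (0 : ℝ)..l, w x * φ x := by
    refine intervalIntegral.integral_congr_ae ?_
    filter_upwards [hi.ae_hasDerivAt_integral] with x hx hxm
    rw [(hx (uIoc_subset_uIcc hxm) 0 (by simp)).deriv]
  have hφi : IntervalIntegrable (deriv φ) volume 0 l :=
    hφ.continuous_deriv.intervalIntegrable _ _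
  have hφ0 : φ 0 = 0 := hφ.eq_zero_of_notMem (by simp)
  have hφl : φ l = 0 := hφ.eq_zero_of_notMem (by simp)
  simp only [setIntegral_Ioo_eq_intervalIntegral hl, add_mul]
  rw [intervalIntegral.integral_add (hφi.const_mul c) (hφi.continuousOn_mul hac.continuousOn),
    hac.integral_mul_deriv_eq_deriv_mul hφac, intervalIntegral.integral_const_mul,
    hφ.intervalIntegral_deriv, hderiv, hφ0, hφl]
  ring

/-- The du Bois-Reymond lemma. -/
theorem HasWeakDeriv.exists_ae_eq_const {l : ℝ} (hl : 0 < l) {g : ℝ → ℝ}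
    (hg : IntegrableOn g (Ioo 0 l)) (h : HasWeakDeriv l g 0) :
    ∃ c, g =ᵐ[volume.restrict (Ioo 0 l)] fun _ => c := by
  obtain ⟨η, hη, hη1⟩ := exists_isTestFunction_integral_eq_one hl
  set c := ∫ x, g x * η x with hc
  refine ⟨c, (ae_restrict_iff' measurableSet_Ioo).2 ?_⟩
  suffices ∀ᵐ x, x ∈ Ioo 0 l → g x - c = 0 by
    filter_upwards [this] with x hx hxm using sub_eq_zero.1 (hx hxm)
  refine isOpen_Ioo.ae_eq_zero_of_integral_contDiff_smul_eq_zero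
    (hg.sub (integrableOn_const (by simp))).locallyIntegrableOn fun ψ hψ hψc hψs => ?_
  have hψt : IsTestFunction l ψ := ⟨hψ, hψc, hψs⟩
  have hint {θ : ℝ → ℝ} (hθ : IsTestFunction l θ) : Integrable fun x => g x * θ x := by
    refine (integrableOn_iff_integrable_of_support_subset fun x hx => ?_).1
      (integrableOn_Ioo_mul_continuous hg hθ.1.continuous)
    by_contra hx'
    exact hx (by simp only [hθ.eq_zero_of_notMem hx', mul_zero])
  have hψi : Integrable ψ := hψ.continuous.integrable_of_hasCompactSupport hψc
  have hηi : Integrable η := hη.1.continuous.integrable_of_hasCompactSupport hη.2.1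
  set I := ∫ x, ψ x
  -- `ψ - I η` has mean zero, so it is the derivative of a test function.
  have hθ : IsTestFunction l fun x => ψ x - I * η x := hψt.sub_const_mul hη I
  have hmean : ∫ x in (0 : ℝ)..l, (ψ x - I * η x) = 0 := by
    have hfull := hθ.setIntegral_mul fun _ => 1
    simp only [one_mul] at hfull
    rw [← setIntegral_Ioo_eq_intervalIntegral hl.le, hfull, integral_sub hψi (hηi.const_mul I),
      integral_const_mul, hη1, mul_one, sub_self]
  have horth : ∫ x, g x * (ψ x - I * η x) = 0 := by
    have hprim := h _ (hθ.primitive hmean)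
    rw [funext (hθ.1.continuous.deriv_integral _ 0)] at hprim
    rw [← hθ.setIntegral_mul, hprim]
    simp only [Pi.zero_apply, zero_mul, integral_zero, neg_zero]
  calc ∫ x, ψ x • (g x - c)
      = (∫ x, g x * ψ x) - c * I := by
        rw [← integral_const_mul, ← integral_sub (hint hψt) (hψi.const_mul c)]
        exact integral_congr_ae (.of_forall fun x => by simp only [smul_eq_mul]; ring)
    _ = ∫ x, g x * (ψ x - I * η x) := by
        rw [hc, mul_comm, ← integral_const_mul, ← integral_sub (hint hψt) ((hint hη).const_mul I)]
        exact integral_congr_ae (.of_forall fun x => by ring)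
    _ = 0 := horth

theorem eqOn_Icc_of_ae_eq_Ioo {X : Type*} [TopologicalSpace X] [T2Space X] {a b : ℝ} (hab : a < b)
    {f g : ℝ → X} (h : f =ᵐ[volume.restrict (Ioo a b)] g) (hf : ContinuousOn f (Icc a b))
    (hg : ContinuousOn g (Icc a b)) : EqOn f g (Icc a b) :=
  Measure.eqOn_Icc_of_ae_eq volume hab.ne (by rwa [← restrict_Ioo_eq_restrict_Icc]) hf hg

namespace IsSobolev

variable {l : ℝ} {z w : ℝ → ℝ}

theorem integrableOn_deriv (h : IsSobolev l z w) : IntegrableOn w (Ioo 0 l) :=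
  h.memLp_deriv.integrable (by norm_num)

theorem integral_deriv (hl : 0 < l) (h : IsSobolev l z w) {a b : ℝ} (ha : a ∈ Icc 0 l)
    (hb : b ∈ Icc 0 l) : ∫ x in a..b, w x = z b - z a := by
  have hw := h.integrableOn_deriv
  set F : ℝ → ℝ := fun x => 0 + ∫ t in (0 : ℝ)..x, w t
  have hF : ContinuousOn F (Icc 0 l) := continuousOn_const.add (continuousOn_primitive_Icc hw)
  have hFi : IntegrableOn F (Ioo 0 l) := hF.integrableOn_Icc.mono_set Ioo_subset_Icc_self
  have hzi : IntegrableOn z (Ioo 0 l) := h.memLp.integrable (by norm_num)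
  have hweak : HasWeakDeriv l (z - F) 0 := by
    simpa only [sub_self] using
      h.weakDeriv.sub (hasWeakDeriv_primitive hl.le hw 0) hzi hFi hw hw
  obtain ⟨c, hae⟩ := hweak.exists_ae_eq_const hl (hzi.sub hFi)
  have hc : EqOn (z - F) (fun _ => c) (Icc 0 l) :=
    eqOn_Icc_of_ae_eq_Ioo hl hae (h.continuousOn.sub hF) continuousOn_const
  have h0 : (0 : ℝ) ∈ Icc 0 l := ⟨le_rfl, hl.le⟩
  have hsplit : ∫ x in a..b, w x = F b - F a := by
    simp only [F, zero_add]
    exact (intervalIntegral.integral_interval_sub_left (intervalIntegrable_of_mem_Icc hw h0 hb)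
      (intervalIntegrable_of_mem_Icc hw h0 ha)).symm
  have hca : z a - F a = c := hc ha
  have hcb : z b - F b = c := hc hb
  rw [hsplit]
  linarith

end IsSobolev

theorem isSobolev_primitive {l : ℝ} (hl : 0 ≤ l) {w : ℝ → ℝ}
    (hw : MemLp w 2 (volume.restrict (Ioo 0 l))) (c : ℝ) :
    IsSobolev l (fun x => c + ∫ t in (0 : ℝ)..x, w t) w := by
  have hi : IntegrableOn w (Ioo 0 l) := hw.integrable (by norm_num)
  have hcont : ContinuousOn (fun x => c + ∫ t in (0 : ℝ)..x, w t) (Icc 0 l) :=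
    continuousOn_const.add (continuousOn_primitive_Icc hi)
  refine ⟨?_, hw, hasWeakDeriv_primitive hl hi c, hcont⟩
  obtain ⟨K, hK⟩ := isCompact_Icc.exists_bound_of_continuousOn hcont
  refine MemLp.of_bound ((hcont.mono Ioo_subset_Icc_self).aestronglyMeasurable
    measurableSet_Ioo) K ?_
  filter_upwards [ae_restrict_mem measurableSet_Ioo] with x hx using hK x (Ioo_subset_Icc_self hx)

theorem enorm_le_of_eLpNorm_top_le {a b : ℝ} (hab : a < b) {z : ℝ → ℝ}
    (hz : ContinuousOn z (Icc a b)) {C : ℝ≥0∞}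
    (h : eLpNorm z ∞ (volume.restrict (Ioo a b)) ≤ C) {x : ℝ} (hx : x ∈ Icc a b) : ‖z x‖ₑ ≤ C := by
  rw [eLpNorm_exponent_top] at h
  have hae : (fun x => min ‖z x‖ₑ C) =ᵐ[volume.restrict (Ioo a b)] fun x => ‖z x‖ₑ := by
    filter_upwards [enorm_ae_le_eLpNormEssSup z (volume.restrict (Ioo a b))] with x hx
    exact min_eq_left (hx.trans h)
  exact min_eq_left_iff.1 <|
    eqOn_Icc_of_ae_eq_Ioo hab hae (hz.enorm.inf continuousOn_const) hz.enorm hx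

/-! ### Functions of bounded variation on an interval -/

theorem isBV_const (l c : ℝ) : IsBV l fun _ => c := by
  refine ⟨integrableOn_const (by simp), 0, 0, inferInstance, inferInstance, fun φ hφ => ?_⟩
  rw [integral_const_mul, hφ.setIntegral_deriv]
  simp

theorem isBV_indicator_Ioo {l a b : ℝ} (ha : 0 ≤ a) (hab : a ≤ b) (hb : b ≤ l) :
    IsBV l ((Ioo a b).indicator fun _ => 1) := by
  refine ⟨(integrableOn_const (by simp)).indicator measurableSet_Ioo, Measure.dirac a,
    Measure.dirac b, inferInstance, inferInstance, fun φ hφ => ?_⟩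
  simp only [← indicator_mul_left, one_mul]
  rw [setIntegral_indicator measurableSet_Ioo,
    inter_eq_self_of_subset_right (Ioo_subset_Ioo ha hb), setIntegral_Ioo_eq_intervalIntegral hab,
    hφ.intervalIntegral_deriv, integral_dirac, integral_dirac, neg_sub]

namespace IsBV

variable {l : ℝ} {u v : ℝ → ℝ}

theorem congr (hu : IsBV l u) (huv : EqOn u v (Ioo 0 l)) : IsBV l v := by
  obtain ⟨hi, μ, ν, hμ, hν, h⟩ := hu
  refine ⟨hi.congr_fun huv measurableSet_Ioo, μ, ν, hμ, hν, fun φ hφ => ?_⟩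
  rw [← h φ hφ]
  exact setIntegral_congr_fun measurableSet_Ioo fun x hx => by simp only [huv hx]

theorem add (hu : IsBV l u) (hv : IsBV l v) : IsBV l fun x => u x + v x := by
  obtain ⟨hui, μ₁, ν₁, hμ₁, hν₁, h₁⟩ := hu
  obtain ⟨hvi, μ₂, ν₂, hμ₂, hν₂, h₂⟩ := hv
  refine ⟨hui.add hvi, μ₁ + μ₂, ν₁ + ν₂, inferInstance, inferInstance, fun φ hφ => ?_⟩
  have hint (μ : Measure ℝ) [IsFiniteMeasure μ] : Integrable φ μ :=
    hφ.1.continuous.integrable_of_hasCompactSupport hφ.2.1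
  simp only [add_mul]
  rw [integral_add (integrableOn_Ioo_mul_continuous hui hφ.continuous_deriv)
    (integrableOn_Ioo_mul_continuous hvi hφ.continuous_deriv), h₁ φ hφ, h₂ φ hφ,
    integral_add_measure (hint _) (hint _), integral_add_measure (hint _) (hint _)]
  ring

theorem const_mul (hu : IsBV l u) (c : ℝ) : IsBV l fun x => c * u x := by
  obtain ⟨hi, μ, ν, hμ, hν, h⟩ := hu
  refine ⟨hi.const_mul c, c.toNNReal • μ + (-c).toNNReal • ν, c.toNNReal • ν + (-c).toNNReal • μ,
    inferInstance, inferInstance, fun φ hφ => ?_⟩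
  have hint (μ : Measure ℝ) [IsFiniteMeasure μ] : Integrable φ μ :=
    hφ.1.continuous.integrable_of_hasCompactSupport hφ.2.1
  have hc : (c.toNNReal : ℝ) - ((-c).toNNReal : ℝ) = c := by
    simpa only [Real.coe_toNNReal', max_comm] using max_zero_sub_max_neg_zero_eq_self c
  simp only [mul_assoc]
  rw [integral_const_mul, h φ hφ, integral_add_measure (hint _) (hint _),
    integral_add_measure (hint _) (hint _)]
  simp only [integral_smul_nnreal_measure, NNReal.smul_def, smul_eq_mul]
  linear_combination (-(∫ x, φ x ∂μ) + ∫ x, φ x ∂ν) * -hc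

theorem indicator_sdiff {D : Set ℝ} (hD : IsBV l (D.indicator fun _ => 1)) :
    IsBV l ((Ioo 0 l \ D).indicator fun _ => 1) := by
  refine ((isBV_const l 1).add (hD.const_mul (-1))).congr fun x hx => ?_
  by_cases hxD : x ∈ D <;> simp [hx, hxD]

end IsBV

/-! ### Circulations with bounded capacities -/

theorem exists_mem_forall_inner_nonneg {F H : Type*} [AddCommGroup F] [Module ℝ F]
    [TopologicalSpace F] [NormedAddCommGroup H] [InnerProductSpace ℝ H] {K : Set F}
    (hne : K.Nonempty) (hK : IsCompact K) (hconv : Convex ℝ K) {A : F →ₗ[ℝ] H}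
    (hA : Continuous A) (u : H) :
    ∃ x ∈ K, ∀ y ∈ K, 0 ≤ inner ℝ (A x - u) (A y - A x) := by
  have hAconv : Convex ℝ (A '' K) := hconv.linear_image A
  obtain ⟨_, ⟨x, hx, rfl⟩, hmin⟩ := exists_norm_eq_iInf_of_complete_convex (hne.image A)
    (hK.image hA).isComplete hAconv u
  refine ⟨x, hx, fun y hy => ?_⟩
  have := (norm_eq_iInf_iff_real_inner_le_zero hAconv (mem_image_of_mem A hx)).1 hmin (A y)
    (mem_image_of_mem A hy)
  rwa [← neg_sub, inner_neg_left, neg_nonpos] at this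

theorem sign_of_forall_sum_mul_sub_nonneg {E : Type*} [Fintype E] {a b d f : E → ℝ}
    (hf : f ∈ Icc a b) (h : ∀ y ∈ Icc a b, 0 ≤ ∑ e, d e * (y e - f e)) (e : E) :
    (f e < b e → 0 ≤ d e) ∧ (a e < f e → d e ≤ 0) := by
  classical
  have hupd (t : ℝ) (hat : a e ≤ t) (htb : t ≤ b e) : 0 ≤ d e * (t - f e) := by
    have hmem : Function.update f e t ∈ Icc a b :=
      ⟨le_update_iff.2 ⟨hat, fun i _ => hf.1 i⟩, update_le_iff.2 ⟨htb, fun i _ => hf.2 i⟩⟩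
    have hsum := h _ hmem
    rwa [Finset.sum_eq_single e (fun i _ hi => by simp [hi]) (by simp),
      Function.update_self] at hsum
  have hab : a e ≤ b e := (hf.1 e).trans (hf.2 e)
  refine ⟨fun hlt => nonneg_of_mul_nonneg_left (hupd (b e) hab le_rfl) (sub_pos.2 hlt),
    fun hlt => ?_⟩
  have := hupd (a e) le_rfl hab
  rw [← neg_sub, mul_neg, ← neg_mul] at this
  exact neg_nonneg.1 (nonneg_of_mul_nonneg_left this (sub_pos.2 hlt))

section Flow

variable {V E : Type*} [Fintype E] [DecidableEq V] (init term : E → V)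

/-- The net inflow at `v` when the edge `e` carries `x e` out of `init e` and `y e` into
`term e`. -/
def netInflow (x y : E → ℝ) (v : V) : ℝ :=
  ∑ e, ((if term e = v then y e else 0) - if init e = v then x e else 0)

/-- The least net inflow into the vertex set `S` when the edge `e` carries some amount
`f e ∈ [a e, b e]` out of `init e` and the amount `f e + g e` into `term e`. -/
def minInflow (a b g : E → ℝ) (S : Finset V) : ℝ :=
  ∑ e, if term e ∈ S then if init e ∈ S then g e else a e + g e
    else if init e ∈ S then -b e else 0

theorem netInflow_add (x y x' y' : E → ℝ) (v : V) :
    netInflow init term (x + x') (y + y') v =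
      netInflow init term x y v + netInflow init term x' y' v := by
  simp only [netInflow, Pi.add_apply, ← Finset.sum_add_distrib]
  exact Finset.sum_congr rfl fun e _ => by split_ifs <;> ring

theorem netInflow_smul (c : ℝ) (x y : E → ℝ) (v : V) :
    netInflow init term (c • x) (c • y) v = c * netInflow init term x y v := by
  simp only [netInflow, Pi.smul_apply, smul_eq_mul, Finset.mul_sum]
  exact Finset.sum_congr rfl fun e _ => by split_ifs <;> ring

theorem sum_netInflow (x y : E → ℝ) (S : Finset V) :
    ∑ v ∈ S, netInflow init term x y v =
      ∑ e, ((if term e ∈ S then y e else 0) - if init e ∈ S then x e else 0) := by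
  simp only [netInflow]
  rw [Finset.sum_comm]
  simp only [Finset.sum_sub_distrib, Finset.sum_ite_eq]

theorem sum_mul_netInflow [Fintype V] (p : V → ℝ) (x y : E → ℝ) :
    ∑ v, p v * netInflow init term x y v = ∑ e, (p (term e) * y e - p (init e) * x e) := by
  simp only [netInflow, Finset.mul_sum]
  rw [Finset.sum_comm]
  simp only [mul_sub, mul_ite, mul_zero, Finset.sum_sub_distrib, Finset.sum_ite_eq,
    Finset.mem_univ, if_true]

variable {init term} {a b g : E → ℝ}

theorem exists_mem_Icc_forall_sum_potential_nonneg [Finite V] (hab : a ≤ b) :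
    ∃ f ∈ Icc a b, ∀ y ∈ Icc a b,
      0 ≤ ∑ e, (netInflow init term f (f + g) (term e) - netInflow init term f (f + g) (init e)) *
        (y e - f e) := by
  have := Fintype.ofFinite V
  let A : (E → ℝ) →ₗ[ℝ] EuclideanSpace ℝ V :=
    { toFun := fun f => WithLp.toLp 2 (netInflow init term f f)
      map_add' := fun x y => by ext v; exact netInflow_add init term x x y y v
      map_smul' := fun c x => by ext v; exact netInflow_smul init term c x x v }
  obtain ⟨f, hf, hmin⟩ := exists_mem_forall_inner_nonneg (nonempty_Icc.2 hab) isCompact_Icc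
    (convex_Icc a b) A.continuous_of_finiteDimensional
    (-WithLp.toLp 2 (netInflow init term 0 g))
  refine ⟨f, hf, fun y hy => (hmin y hy).trans_eq ?_⟩
  have hp (v : V) : (A f - -WithLp.toLp 2 (netInflow init term 0 g)) v =
      netInflow init term f (f + g) v := by
    rw [sub_neg_eq_add]
    exact (netInflow_add init term f f 0 g v).symm.trans (by rw [add_zero])
  have hd (v : V) : (A y - A f) v = netInflow init term (y - f) (y - f) v := by
    rw [← map_sub]
    rfl
  simp only [PiLp.inner_apply, hp, hd, RCLike.inner_apply, conj_trivial]
  simp only [mul_comm (netInflow init term (y - f) (y - f) _), sum_mul_netInflow, Pi.sub_apply,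
    sub_mul]

theorem netInflow_le_minInflow {f : E → ℝ} (hf : f ∈ Icc a b)
    (hvar : ∀ y ∈ Icc a b,
      0 ≤ ∑ e, (netInflow init term f (f + g) (term e) - netInflow init term f (f + g) (init e)) *
        (y e - f e))
    {S : Finset V} (hS : ∀ v, v ∈ S ↔ 0 < netInflow init term f (f + g) v) :
    ∑ v ∈ S, netInflow init term f (f + g) v ≤ minInflow init term a b g S := by
  rw [sum_netInflow]
  refine Finset.sum_le_sum fun e _ => ?_
  obtain ⟨hup, hdown⟩ := sign_of_forall_sum_mul_sub_nonneg hf hvar e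
  simp only [Pi.add_apply]
  by_cases ht : term e ∈ S <;> by_cases hi : init e ∈ S <;> simp only [ht, hi, if_true, if_false]
  · linarith
  · have : f e ≤ a e := not_lt.1 fun h => by linarith [hdown h, (hS _).1 ht, mt (hS _).2 hi]
    linarith [hf.1 e]
  · have : b e ≤ f e := not_lt.1 fun h => by linarith [hup h, (hS _).1 hi, mt (hS _).2 ht]
    linarith [hf.2 e]
  · exact (sub_zero 0).le

/-- Hoffman's circulation theorem, for edges with prescribed gains `g`: if no vertex set is forced
to have positive net inflow, then some flow within the capacities `[a e, b e]` is conserved. -/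
theorem exists_netInflow_eq_zero [Finite V] (hab : a ≤ b) (hg : ∑ e, g e = 0)
    (hcut : ∀ S, minInflow init term a b g S ≤ 0) :
    ∃ f ∈ Icc a b, ∀ v, netInflow init term f (f + g) v = 0 := by
  have := Fintype.ofFinite V
  -- Minimise the sum of the squares of the net inflows; the vertices with positive net inflow in a
  -- minimiser form a set `S` whose net inflow is the least possible.
  obtain ⟨f, hf, hvar⟩ :=
    exists_mem_Icc_forall_sum_potential_nonneg (init := init) (term := term) (g := g) hab
  set p := netInflow init term f (f + g)
  let S := Finset.univ.filter fun v => 0 < p v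
  have hS (v : V) : v ∈ S ↔ 0 < p v := by simp [S]
  have hsumS : ∑ v ∈ S, p v ≤ 0 := (netInflow_le_minInflow hf hvar hS).trans (hcut S)
  have hp : ∀ v, p v ≤ 0 := fun v => not_lt.1 fun hv => by
    have := Finset.single_le_sum (f := p) (fun w hw => ((hS w).1 hw).le) ((hS v).2 hv)
    linarith
  have hsum : ∑ v, p v = 0 := by
    simp [p, sum_netInflow, hg]
  exact ⟨f, hf, fun v => (Finset.sum_eq_zero_iff_of_nonpos fun v _ => hp v).1 hsum v
    (Finset.mem_univ v)⟩

end Flow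

theorem exists_abs_le_one_mul_eq {x y : ℝ} (h : |x| ≤ y) : ∃ k, |k| ≤ 1 ∧ k * y = x := by
  have hy : 0 ≤ y := (abs_nonneg x).trans h
  refine ⟨x / y, ?_, div_mul_cancel_of_imp fun hy0 => abs_nonpos_iff.1 (hy0 ▸ h)⟩
  rw [abs_div, abs_of_nonneg hy]
  exact div_le_one_of_le₀ h hy

theorem exists_forall_div_mul_le {ι X : Type*} [Finite ι] [TopologicalSpace X] {K : ι → Set X}
    {m : X → ℝ} {b : ι → ℝ} (hK : ∀ i, IsCompact (K i)) (hm : ∀ i, ContinuousOn m (K i))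
    (hb : ∀ i, 0 ≤ b i) (hpos : ∃ i, ∃ x ∈ K i, 0 < m x) :
    ∃ i, ∃ x ∈ K i, 0 < m x ∧ ∀ j, ∀ y ∈ K j, b i / m x * m y ≤ b j := by
  let I := {i | ∃ x ∈ K i, 0 < m x}
  have : Nonempty I := nonempty_subtype.2 hpos
  choose P hPK hPmax using fun i : I =>
    (hK i).exists_isMaxOn (i.2.imp fun _ => And.left) (hm i)
  have hPpos (i : I) : 0 < m (P i) :=
    have ⟨_, hx, hmx⟩ := i.2
    hmx.trans_le (hPmax i hx)
  obtain ⟨i, hi⟩ := Finite.exists_min fun i : I => b i / m (P i)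
  refine ⟨i, P i, hPK i, hPpos i, fun j y hy => ?_⟩
  have hr : 0 ≤ b i / m (P i) := div_nonneg (hb i) (hPpos i).le
  rcases le_or_gt (m y) 0 with hmy | hmy
  · exact (mul_nonpos_of_nonneg_of_nonpos hr hmy).trans (hb j)
  · let j' : I := ⟨j, y, hy, hmy⟩
    calc b i / m (P i) * m y ≤ b i / m (P i) * m (P j') :=
          mul_le_mul_of_nonneg_left (hPmax j' hy) hr
      _ ≤ b j := (le_div_iff₀ (hPpos j')).1 (hi j')

namespace CompactMetricGraph

variable {V E : Type*} {Γ : CompactMetricGraph V E}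

/-! ### Integrals and sets on the graph -/

section Integral

/-- A (Lebesgue) measurable subset of the graph. -/
structure IsMeasurableSubset (Γ : CompactMetricGraph V E) (D : E → Set ℝ) : Prop where
  subset : ∀ e, D e ⊆ Ioo 0 (Γ.len e)
  measurable : ∀ e, NullMeasurableSet (D e) volume

theorem IsFinitePerimeter.isMeasurableSubset {D : E → Set ℝ} (hD : Γ.IsFinitePerimeter D) :
    Γ.IsMeasurableSubset D :=
  ⟨hD.subset, hD.measurable⟩

theorem IsMeasurableSubset.compl {D : E → Set ℝ} (hD : Γ.IsMeasurableSubset D) :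
    Γ.IsMeasurableSubset (Γ.compl D) where
  subset _ := sdiff_subset
  measurable e := measurableSet_Ioo.nullMeasurableSet.diff (hD.measurable e)

theorem IsFinitePerimeter.compl {D : E → Set ℝ} (hD : Γ.IsFinitePerimeter D) :
    Γ.IsFinitePerimeter (Γ.compl D) where
  subset := hD.isMeasurableSubset.compl.subset
  measurable := hD.isMeasurableSubset.compl.measurable
  memBV e := (hD.memBV e).indicator_sdiff

theorem isMeasurableSubset_superlevel {u : E → ℝ → ℝ}
    (hu : ∀ e, IntegrableOn (u e) (Ioo 0 (Γ.len e))) (t : ℝ) :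
    Γ.IsMeasurableSubset (Γ.superlevel u t) where
  subset _ := sep_subset _ _
  measurable e := by
    have h := nullMeasurableSet_lt (aemeasurable_const (b := t)) (hu e).aemeasurable
    rwa [nullMeasurableSet_restrict measurableSet_Ioo.nullMeasurableSet, inter_comm] at h

theorem isMeasurableSubset_sublevel {u : E → ℝ → ℝ}
    (hu : ∀ e, IntegrableOn (u e) (Ioo 0 (Γ.len e))) (t : ℝ) :
    Γ.IsMeasurableSubset (Γ.sublevel u t) where
  subset _ := sep_subset _ _
  measurable e := by
    have h := nullMeasurableSet_lt (hu e).aemeasurable (aemeasurable_const (b := t))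
    rwa [nullMeasurableSet_restrict measurableSet_Ioo.nullMeasurableSet, inter_comm] at h

theorem IsMeasurableSubset.integrableOn_char {D : E → Set ℝ} (hD : Γ.IsMeasurableSubset D)
    (e : E) : IntegrableOn (char D e) (Ioo 0 (Γ.len e)) :=
  Integrable.indicator₀ (integrableOn_const (by simp))
    ((hD.measurable e).mono Measure.restrict_le_self)

variable [Fintype E]

theorem integral_add {u v : E → ℝ → ℝ} (hu : ∀ e, IntegrableOn (u e) (Ioo 0 (Γ.len e)))
    (hv : ∀ e, IntegrableOn (v e) (Ioo 0 (Γ.len e))) :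
    (Γ.integral fun e x => u e x + v e x) = Γ.integral u + Γ.integral v := by
  simp only [integral, ← Finset.sum_add_distrib]
  exact Finset.sum_congr rfl fun e _ => MeasureTheory.integral_add (hu e) (hv e)

theorem integral_const_mul (c : ℝ) (u : E → ℝ → ℝ) :
    (Γ.integral fun e x => c * u e x) = c * Γ.integral u := by
  simp only [integral, MeasureTheory.integral_const_mul, Finset.mul_sum]

theorem integral_const (c : ℝ) : (Γ.integral fun _ _ => c) = c * ∑ e, Γ.len e := by
  simp only [integral, Finset.mul_sum, setIntegral_const, smul_eq_mul]
  exact Finset.sum_congr rfl fun e _ => by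
    rw [Real.volume_real_Ioo_of_le (Γ.len_pos e).le, sub_zero, mul_comm]

/-- The integral over the subset `D` of the graph. -/
noncomputable def integralOn (D : E → Set ℝ) (w : E → ℝ → ℝ) : ℝ := ∑ e, ∫ x in D e, w e x

/-- The length of the smaller of the two sides of the partition `(D, Γ ∖ D)`. -/
noncomputable def minorLength (Γ : CompactMetricGraph V E) (D : E → Set ℝ) : ℝ≥0∞ :=
  min (length D) (length (Γ.compl D))

theorem totalLength_eq_ofReal : Γ.totalLength = ENNReal.ofReal (∑ e, Γ.len e) :=
  (ENNReal.ofReal_sum_of_nonneg fun e _ => (Γ.len_pos e).le).symm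

theorem totalLength_ne_top : Γ.totalLength ≠ ⊤ :=
  totalLength_eq_ofReal.trans_ne ENNReal.ofReal_ne_top

theorem sum_len_nonneg : 0 ≤ ∑ e, Γ.len e :=
  Finset.sum_nonneg fun e _ => (Γ.len_pos e).le

theorem toReal_totalLength : Γ.totalLength.toReal = ∑ e, Γ.len e := by
  rw [totalLength_eq_ofReal, ENNReal.toReal_ofReal sum_len_nonneg]

namespace IsMeasurableSubset

variable {D : E → Set ℝ}

theorem length_add_length_compl (hD : Γ.IsMeasurableSubset D) :
    length D + length (Γ.compl D) = Γ.totalLength := by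
  simp only [length, totalLength, CompactMetricGraph.compl, ← Finset.sum_add_distrib]
  refine Finset.sum_congr rfl fun e _ => ?_
  rw [← measure_union₀ (measurableSet_Ioo.nullMeasurableSet.diff (hD.measurable e))
    disjoint_sdiff_right.aedisjoint, union_sdiff_cancel (hD.subset e), Real.volume_Ioo, sub_zero]

theorem length_ne_top (hD : Γ.IsMeasurableSubset D) : length D ≠ ⊤ :=
  ne_top_of_le_ne_top totalLength_ne_top (hD.length_add_length_compl ▸ le_self_add)

theorem length_compl_ne_top (hD : Γ.IsMeasurableSubset D) : length (Γ.compl D) ≠ ⊤ :=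
  ne_top_of_le_ne_top totalLength_ne_top (hD.length_add_length_compl ▸ le_add_self)

theorem length_compl_pos (hD : Γ.IsMeasurableSubset D) (h : length D < Γ.totalLength) :
    0 < length (Γ.compl D) :=
  pos_iff_ne_zero.2 fun h0 => h.ne (by rw [← hD.length_add_length_compl, h0, add_zero])

theorem minorLength_le (hD : Γ.IsMeasurableSubset D) : Γ.minorLength D ≤ Γ.totalLength / 2 := by
  rw [ENNReal.le_div_iff_mul_le (by simp) (by simp), mul_two, ← hD.length_add_length_compl]
  exact add_le_add (min_le_left _ _) (min_le_right _ _)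

theorem integral_char_mul (hD : Γ.IsMeasurableSubset D) (w : E → ℝ → ℝ) :
    (Γ.integral fun e x => char D e x * w e x) = integralOn D w := by
  refine Finset.sum_congr rfl fun e _ => ?_
  simp only [char, ← indicator_mul_left, one_mul]
  rw [setIntegral_eq_integral_of_forall_compl_eq_zero fun x hx =>
    indicator_of_notMem (fun h => hx (hD.subset e h)) (w e), integral_indicator₀ (hD.measurable e)]

theorem integral_char (hD : Γ.IsMeasurableSubset D) :
    Γ.integral (char D) = (length D).toReal := by
  have h := hD.integral_char_mul fun _ _ => 1
  simp only [mul_one, integralOn, setIntegral_const, smul_eq_mul] at h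
  rw [length, ENNReal.toReal_sum (ENNReal.sum_ne_top.1 hD.length_ne_top)]
  exact h

theorem integralOn_compl (hD : Γ.IsMeasurableSubset D) {w : E → ℝ → ℝ}
    (hw : ∀ e, IntegrableOn (w e) (Ioo 0 (Γ.len e))) :
    integralOn (Γ.compl D) w = Γ.integral w - integralOn D w := by
  rw [integralOn, integralOn, integral, ← Finset.sum_sub_distrib]
  exact Finset.sum_congr rfl fun e _ => setIntegral_sdiff₀ (hD.measurable e) (hw e) (hD.subset e)

theorem abs_integralOn_le (hD : Γ.IsMeasurableSubset D) {w : E → ℝ → ℝ}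
    (hw : ∀ e x, |w e x| ≤ 1) : |integralOn D w| ≤ (length D).toReal := by
  have hfin := ENNReal.sum_ne_top.1 hD.length_ne_top
  rw [length, ENNReal.toReal_sum hfin]
  refine (Finset.abs_sum_le_sum_abs _ _).trans (Finset.sum_le_sum fun e he => ?_)
  exact (norm_setIntegral_le_of_norm_le_const (f := w e) (hfin e he).lt_top
    fun x _ => hw e x).trans_eq (one_mul _)

end IsMeasurableSubset

end Integral

/-! ### Kirchhoff vector fields and the total variation -/

section TotalVariation

variable [Fintype E]

theorem sum_outwardValue_eq_netInflow [DecidableEq V] (z : E → ℝ → ℝ) (v : V) :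
    ∑ e ∈ Γ.incidentEdges v, Γ.outwardValue z e v =
      netInflow Γ.init Γ.term (fun e => z e 0) (fun e => z e (Γ.len e)) v := by
  unfold incidentEdges outwardValue netInflow
  rw [Finset.sum_filter]
  refine Finset.sum_congr rfl fun e _ => ?_
  by_cases ht : Γ.term e = v
  · have hi : Γ.init e ≠ v := fun hi => Γ.no_loops e (hi.trans ht.symm)
    simp [ht, hi]
  · by_cases hi : Γ.init e = v <;> simp [ht, hi]

namespace IsKirchhoff

variable {z w : E → ℝ → ℝ}

theorem sum_boundary_eq_zero [DecidableEq V] (h : Γ.IsKirchhoff z w) (S : Finset V) :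
    ∑ e, ((if Γ.term e ∈ S then z e (Γ.len e) else 0) - if Γ.init e ∈ S then z e 0 else 0) = 0 := by
  rw [← sum_netInflow Γ.init Γ.term (fun e => z e 0) fun e => z e (Γ.len e)]
  exact Finset.sum_eq_zero fun v _ => by rw [← sum_outwardValue_eq_netInflow, h.kirchhoff]

theorem integral_deriv_eq_zero [Finite V] (h : Γ.IsKirchhoff z w) : Γ.integral w = 0 := by
  classical
  have := Fintype.ofFinite V
  rw [← h.sum_boundary_eq_zero Finset.univ]
  refine Finset.sum_congr rfl fun e _ => ?_
  have hl := Γ.len_pos e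
  rw [setIntegral_Ioo_eq_intervalIntegral hl.le, (h.sobolev e).integral_deriv hl ⟨le_rfl, hl.le⟩
    ⟨hl.le, le_rfl⟩, if_pos (Finset.mem_univ _), if_pos (Finset.mem_univ _)]

theorem abs_le_one (h : Γ.IsKirchhoff z w)
    (hz : ∀ e, eLpNorm (z e) ∞ (volume.restrict (Ioo 0 (Γ.len e))) ≤ 1) (e : E) {x : ℝ}
    (hx : x ∈ Icc 0 (Γ.len e)) : |z e x| ≤ 1 := by
  have := enorm_le_of_eLpNorm_top_le (Γ.len_pos e) (h.sobolev e).continuousOn (hz e) hx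
  rwa [Real.enorm_eq_ofReal_abs, ENNReal.ofReal_le_one] at this

theorem le_totalVariation (h : Γ.IsKirchhoff z w)
    (hz : ∀ e, eLpNorm (z e) ∞ (volume.restrict (Ioo 0 (Γ.len e))) ≤ 1) (u : E → ℝ → ℝ) :
    ENNReal.ofReal |Γ.integral fun e x => u e x * w e x| ≤ Γ.totalVariation u :=
  le_iSup_of_le z (le_iSup_of_le w (le_iSup_of_le h (le_iSup_of_le hz le_rfl)))

end IsKirchhoff

theorem totalVariation_const_mul (c : ℝ) (u : E → ℝ → ℝ) :
    Γ.totalVariation (fun e x => c * u e x) = ENNReal.ofReal |c| * Γ.totalVariation u := by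
  simp only [totalVariation, mul_assoc, integral_const_mul, abs_mul,
    ENNReal.ofReal_mul (abs_nonneg c), ENNReal.mul_iSup]

namespace IsFinitePerimeter

variable {D : E → Set ℝ}

theorem perimeter_compl [Finite V] (hD : Γ.IsFinitePerimeter D) :
    Γ.perimeter (Γ.compl D) = Γ.perimeter D := by
  refine iSup_congr fun z => iSup_congr fun w => iSup_congr fun h => iSup_congr fun _ => ?_
  rw [hD.compl.isMeasurableSubset.integral_char_mul, hD.isMeasurableSubset.integral_char_mul,
    hD.isMeasurableSubset.integralOn_compl fun e => (h.sobolev e).integrableOn_deriv,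
    h.integral_deriv_eq_zero, zero_sub, abs_neg]

theorem exists_length_eq_minorLength [Finite V] (hD : Γ.IsFinitePerimeter D) :
    ∃ D', Γ.IsFinitePerimeter D' ∧ length D' = Γ.minorLength D ∧
      Γ.perimeter D' = Γ.perimeter D := by
  rcases le_total (length D) (length (Γ.compl D)) with h | h
  · exact ⟨D, hD, (min_eq_left h).symm, rfl⟩
  · exact ⟨Γ.compl D, hD.compl, (min_eq_right h).symm, hD.perimeter_compl⟩

end IsFinitePerimeter

end TotalVariation

/-! ### Elementary cuts -/

section ElementaryCuts

/-- The set whose part in the edge `e` is the interval `(p.1 e, p.2 e)`. -/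
def segments (p : (E → ℝ) × (E → ℝ)) : E → Set ℝ := fun e => Ioo (p.1 e) (p.2 e)

/-- The parameters `p` for which `segments p` consists of one (possibly empty) subinterval of each
edge. -/
def segmentBox (Γ : CompactMetricGraph V E) : Set ((E → ℝ) × (E → ℝ)) :=
  {p | 0 ≤ p.1 ∧ p.1 ≤ p.2 ∧ p.2 ≤ Γ.len}

/-- The elementary cuts are of two kinds: a vertex set `S` with all edges inside `S` and one point
on each edge leaving `S` (`Sum.inl S`), or a segment inside a single edge (`Sum.inr e`). A cut is
encoded by the end points of the intervals it consists of. -/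
def elementaryCuts (Γ : CompactMetricGraph V E) : Finset V ⊕ E → Set ((E → ℝ) × (E → ℝ))
  | Sum.inl S => Γ.segmentBox ∩ {p | ∀ e, (Γ.init e ∈ S → p.1 e = 0) ∧
      (Γ.term e ∈ S → p.2 e = Γ.len e) ∧ (Γ.init e ∉ S → Γ.term e ∉ S → p.1 e = p.2 e)}
  | Sum.inr e₀ => Γ.segmentBox ∩ {p | ∀ e, e ≠ e₀ → p.1 e = p.2 e}

open Classical in
/-- The elementary cut of vertex set `S` that contains the part of the edge `e` after `a e` if `e`
enters `S`, and the part before `b e` if `e` leaves `S`. -/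
noncomputable def vertexCut (Γ : CompactMetricGraph V E) (S : Finset V) (a b : E → ℝ) :
    (E → ℝ) × (E → ℝ) :=
  (fun e => if Γ.init e ∈ S then 0 else if Γ.term e ∈ S then a e else 0,
    fun e => if Γ.term e ∈ S then Γ.len e else if Γ.init e ∈ S then b e else 0)

open Classical in
/-- The elementary cut formed by the interval `(a, b)` of the edge `e₀`. -/
noncomputable def edgeCut (e₀ : E) (a b : ℝ) : (E → ℝ) × (E → ℝ) :=
  (Pi.single e₀ a, Pi.single e₀ b)

theorem elementaryCuts_subset (i : Finset V ⊕ E) : Γ.elementaryCuts i ⊆ Γ.segmentBox := by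
  cases i <;> exact inter_subset_left

theorem fst_mem_Icc {p : (E → ℝ) × (E → ℝ)} (hp : p ∈ Γ.segmentBox) (e : E) :
    p.1 e ∈ Icc 0 (Γ.len e) :=
  ⟨hp.1 e, (hp.2.1 e).trans (hp.2.2 e)⟩

theorem snd_mem_Icc {p : (E → ℝ) × (E → ℝ)} (hp : p ∈ Γ.segmentBox) (e : E) :
    p.2 e ∈ Icc 0 (Γ.len e) :=
  ⟨(hp.1 e).trans (hp.2.1 e), hp.2.2 e⟩

theorem vertexCut_mem {a b : E → ℝ} (ha : ∀ e, a e ∈ Icc 0 (Γ.len e))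
    (hb : ∀ e, b e ∈ Icc 0 (Γ.len e)) (S : Finset V) :
    Γ.vertexCut S a b ∈ Γ.elementaryCuts (Sum.inl S) := by
  have hbox (e : E) : 0 ≤ (Γ.vertexCut S a b).1 e ∧
      (Γ.vertexCut S a b).1 e ≤ (Γ.vertexCut S a b).2 e ∧
      (Γ.vertexCut S a b).2 e ≤ Γ.len e := by
    by_cases hi : Γ.init e ∈ S <;> by_cases ht : Γ.term e ∈ S <;>
      simp [vertexCut, hi, ht, (ha e).1, (ha e).2, (hb e).1, (hb e).2, (Γ.len_pos e).le]
  refine ⟨⟨fun e => (hbox e).1, fun e => (hbox e).2.1, fun e => (hbox e).2.2⟩, fun e => ?_⟩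
  exact ⟨fun hi => if_pos hi, fun ht => if_pos ht, fun hi ht => by simp [vertexCut, hi, ht]⟩

theorem edgeCut_mem {e₀ : E} {a b : ℝ} (ha : 0 ≤ a) (hab : a ≤ b) (hb : b ≤ Γ.len e₀) :
    edgeCut e₀ a b ∈ Γ.elementaryCuts (Sum.inr e₀) := by
  refine ⟨⟨fun e => ?_, fun e => ?_, fun e => ?_⟩,
    fun e he => by simp [edgeCut, he]⟩ <;> rcases eq_or_ne e e₀ with rfl | he
  · simpa [edgeCut] using ha
  · simp [edgeCut, he]
  · simpa [edgeCut] using hab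
  · simp [edgeCut, he]
  · simpa [edgeCut] using hb
  · simpa [edgeCut, he] using (Γ.len_pos e).le

theorem isCompact_segmentBox : IsCompact Γ.segmentBox := by
  refine ((isCompact_Icc (a := (0 : E → ℝ)) (b := Γ.len)).prod
    (isCompact_Icc (a := (0 : E → ℝ)) (b := Γ.len))).of_isClosed_subset ?_ fun p hp =>
    ⟨⟨hp.1, hp.2.1.trans hp.2.2⟩, ⟨hp.1.trans hp.2.1, hp.2.2⟩⟩
  exact (isClosed_le continuous_const continuous_fst).inter <|
    (isClosed_le continuous_fst continuous_snd).inter <|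
    isClosed_le continuous_snd continuous_const

theorem isCompact_elementaryCuts (i : Finset V ⊕ E) : IsCompact (Γ.elementaryCuts i) := by
  cases i with
  | inl S =>
    refine isCompact_segmentBox.inter_right ?_
    simp only [ofPred_forall, ofPred_and]
    refine isClosed_iInter fun e => (isClosed_iInter fun _ => ?_).inter
      ((isClosed_iInter fun _ => ?_).inter
        (isClosed_iInter fun _ => isClosed_iInter fun _ => ?_)) <;>
    exact isClosed_eq (by fun_prop) (by fun_prop)
  | inr e₀ =>
    refine isCompact_segmentBox.inter_right ?_
    simp only [ofPred_forall]
    exact isClosed_iInter fun e => isClosed_iInter fun _ => isClosed_eq (by fun_prop) (by fun_prop)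

theorem isFinitePerimeter_segments {p : (E → ℝ) × (E → ℝ)} (hp : p ∈ Γ.segmentBox) :
    Γ.IsFinitePerimeter (segments p) where
  subset e := Ioo_subset_Ioo (hp.1 e) (hp.2.2 e)
  measurable _ := measurableSet_Ioo.nullMeasurableSet
  memBV e := isBV_indicator_Ioo (hp.1 e) (hp.2.1 e) (hp.2.2 e)

variable [Fintype E]

open Classical in
/-- An upper bound for the number of boundary points of an elementary cut, attained by the generic
cuts of each kind. -/
noncomputable def boundaryCount (Γ : CompactMetricGraph V E) : Finset V ⊕ E → ℝ
  | Sum.inl S => ∑ e, if Γ.init e ∈ S ↔ Γ.term e ∈ S then 0 else 1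
  | Sum.inr _ => 2

theorem boundaryCount_nonneg (i : Finset V ⊕ E) : 0 ≤ Γ.boundaryCount i := by
  cases i with
  | inl S => exact Finset.sum_nonneg fun e _ => by split_ifs <;> norm_num
  | inr e => exact zero_le_two

theorem integralOn_segments {p : (E → ℝ) × (E → ℝ)} (hp : p ∈ Γ.segmentBox) (w : E → ℝ → ℝ) :
    integralOn (segments p) w = ∑ e, ∫ x in (p.1 e)..(p.2 e), w e x :=
  Finset.sum_congr rfl fun e _ => setIntegral_Ioo_eq_intervalIntegral (hp.2.1 e) _

theorem integralOn_segments_edgeCut {e₀ : E} {a b : ℝ} (ha : 0 ≤ a) (hab : a ≤ b)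
    (hb : b ≤ Γ.len e₀) (w : E → ℝ → ℝ) :
    integralOn (segments (edgeCut e₀ a b)) w = ∫ x in a..b, w e₀ x := by
  rw [integralOn_segments (elementaryCuts_subset _ (edgeCut_mem ha hab hb)),
    Finset.sum_eq_single e₀ (fun e _ he => by simp [edgeCut, he]) (by simp)]
  simp [edgeCut]

theorem toReal_minorLength_segments {p : (E → ℝ) × (E → ℝ)} (hp : p ∈ Γ.segmentBox) :
    (Γ.minorLength (segments p)).toReal =
      min (∑ e, (p.2 e - p.1 e)) (∑ e, Γ.len e - ∑ e, (p.2 e - p.1 e)) := by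
  have hD := (isFinitePerimeter_segments hp).isMeasurableSubset
  have hlength : (length (segments p)).toReal = ∑ e, (p.2 e - p.1 e) := by
    simp only [length, segments, Real.volume_Ioo]
    rw [ENNReal.toReal_sum fun _ _ => ENNReal.ofReal_ne_top]
    exact Finset.sum_congr rfl fun e _ => ENNReal.toReal_ofReal (sub_nonneg.2 (hp.2.1 e))
  rw [minorLength, ENNReal.toReal_min hD.length_ne_top hD.length_compl_ne_top, hlength,
    ← toReal_totalLength, ← hD.length_add_length_compl,
    ENNReal.toReal_add hD.length_ne_top hD.length_compl_ne_top, hlength, add_sub_cancel_left]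

theorem continuousOn_toReal_minorLength_segments :
    ContinuousOn (fun p => (Γ.minorLength (segments p)).toReal) Γ.segmentBox :=
  Continuous.continuousOn (by fun_prop) |>.congr fun _ => toReal_minorLength_segments

theorem exists_elementaryCut_minorLength_pos (e₀ : E) :
    ∃ p ∈ Γ.elementaryCuts (Sum.inr e₀), 0 < (Γ.minorLength (segments p)).toReal := by
  have h0 := Γ.len_pos e₀
  have hle : Γ.len e₀ ≤ ∑ e, Γ.len e :=
    Finset.single_le_sum (fun e _ => (Γ.len_pos e).le) (Finset.mem_univ e₀)
  have hmem : edgeCut e₀ 0 (Γ.len e₀ / 2) ∈ Γ.elementaryCuts (Sum.inr e₀) :=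
    edgeCut_mem le_rfl (by linarith) (by linarith)
  refine ⟨_, hmem, ?_⟩
  rw [toReal_minorLength_segments (elementaryCuts_subset _ hmem)]
  simp only [edgeCut, Pi.single_zero, Pi.zero_apply, sub_zero, Finset.sum_pi_single',
    Finset.mem_univ, if_true]
  exact lt_min (by linarith) (by linarith)

theorem exists_optimal_elementaryCut [Finite V] [Nonempty E] :
    ∃ i, ∃ p ∈ Γ.elementaryCuts i, 0 < (Γ.minorLength (segments p)).toReal ∧
      ∀ j, ∀ q ∈ Γ.elementaryCuts j, Γ.boundaryCount i / (Γ.minorLength (segments p)).toReal *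
        (Γ.minorLength (segments q)).toReal ≤ Γ.boundaryCount j :=
  have ⟨e₀⟩ := ‹Nonempty E›
  exists_forall_div_mul_le isCompact_elementaryCuts
    (fun i => continuousOn_toReal_minorLength_segments.mono (elementaryCuts_subset i))
    boundaryCount_nonneg ⟨Sum.inr e₀, exists_elementaryCut_minorLength_pos e₀⟩

variable {i : Finset V ⊕ E} {p : (E → ℝ) × (E → ℝ)}

theorem IsKirchhoff.abs_integralOn_segments_le {z w : E → ℝ → ℝ} (h : Γ.IsKirchhoff z w)
    (hz : ∀ e, eLpNorm (z e) ∞ (volume.restrict (Ioo 0 (Γ.len e))) ≤ 1)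
    (hp : p ∈ Γ.elementaryCuts i) : |integralOn (segments p) w| ≤ Γ.boundaryCount i := by
  classical
  have hbox := elementaryCuts_subset i hp
  have h1 (e : E) : |z e (p.1 e)| ≤ 1 := h.abs_le_one hz e (fst_mem_Icc hbox e)
  have h2 (e : E) : |z e (p.2 e)| ≤ 1 := h.abs_le_one hz e (snd_mem_Icc hbox e)
  have hftc : integralOn (segments p) w = ∑ e, (z e (p.2 e) - z e (p.1 e)) := by
    rw [integralOn_segments hbox]
    exact Finset.sum_congr rfl fun e _ => (h.sobolev e).integral_deriv (Γ.len_pos e)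
      (fst_mem_Icc hbox e) (snd_mem_Icc hbox e)
  rw [hftc]
  cases i with
  | inl S =>
    rw [← sub_zero (∑ e, (z e (p.2 e) - z e (p.1 e))), ← h.sum_boundary_eq_zero S,
      ← Finset.sum_sub_distrib]
    refine (Finset.abs_sum_le_sum_abs _ _).trans (Finset.sum_le_sum fun e _ => ?_)
    obtain ⟨hi, ht, hn⟩ := hp.2 e
    by_cases hti : Γ.term e ∈ S <;> by_cases hii : Γ.init e ∈ S
    · simp [hti, hii, hi hii, ht hti]
    · simpa [hti, hii, ht hti] using h1 e
    · simpa [hti, hii, hi hii] using h2 e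
    · simp [hti, hii, hn hii hti]
  | inr e₀ =>
    rw [Finset.sum_eq_single e₀ (fun e _ he => by rw [hp.2 e he, sub_self]) (by simp)]
    exact (abs_sub _ _).trans ((add_le_add (h2 e₀) (h1 e₀)).trans_eq one_add_one_eq_two)

theorem perimeter_segments_le (hp : p ∈ Γ.elementaryCuts i) :
    Γ.perimeter (segments p) ≤ ENNReal.ofReal (Γ.boundaryCount i) := by
  have hD := (isFinitePerimeter_segments (elementaryCuts_subset i hp)).isMeasurableSubset
  refine iSup_le fun z => iSup_le fun w => iSup_le fun h => iSup_le fun hz =>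
    ENNReal.ofReal_le_ofReal ?_
  rw [hD.integral_char_mul]
  exact h.abs_integralOn_segments_le hz hp

end ElementaryCuts

/-! ### Kirchhoff fields with prescribed derivative -/

section PrescribedDerivative

/-- The primitive of `w` on each edge that vanishes at the initial vertex. -/
noncomputable def primitive (w : E → ℝ → ℝ) : E → ℝ → ℝ := fun e x => ∫ t in (0 : ℝ)..x, w e t

theorem primitive_zero (w : E → ℝ → ℝ) (e : E) : primitive w e 0 = 0 :=
  intervalIntegral.integral_same

section

variable {w : E → ℝ → ℝ} (hw : ∀ e, IntegrableOn (w e) (Ioo 0 (Γ.len e)))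
include hw

theorem primitive_sub_primitive {e : E} {a b : ℝ} (ha : a ∈ Icc 0 (Γ.len e))
    (hb : b ∈ Icc 0 (Γ.len e)) : primitive w e b - primitive w e a = ∫ x in a..b, w e x :=
  have h0 : (0 : ℝ) ∈ Icc 0 (Γ.len e) := ⟨le_rfl, (Γ.len_pos e).le⟩
  intervalIntegral.integral_interval_sub_left (intervalIntegrable_of_mem_Icc (hw e) h0 hb)
    (intervalIntegrable_of_mem_Icc (hw e) h0 ha)

variable [Fintype E]

theorem integralOn_segments_eq_sum_primitive {p : (E → ℝ) × (E → ℝ)} (hp : p ∈ Γ.segmentBox) :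
    integralOn (segments p) w = ∑ e, (primitive w e (p.2 e) - primitive w e (p.1 e)) := by
  rw [integralOn_segments hp]
  exact Finset.sum_congr rfl fun e _ =>
    (primitive_sub_primitive hw (fst_mem_Icc hp e) (snd_mem_Icc hp e)).symm

variable (hcut : ∀ i, ∀ p ∈ Γ.elementaryCuts i, |integralOn (segments p) w| ≤ Γ.boundaryCount i)
include hcut

theorem primitive_sub_primitive_le_two {e : E} {x y : ℝ} (hx : x ∈ Icc 0 (Γ.len e))
    (hy : y ∈ Icc 0 (Γ.len e)) : primitive w e y - primitive w e x ≤ 2 := by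
  have hseg {a b : ℝ} (ha : 0 ≤ a) (hab : a ≤ b) (hb : b ≤ Γ.len e) : |∫ x in a..b, w e x| ≤ 2 := by
    rw [← integralOn_segments_edgeCut ha hab hb]
    exact hcut _ _ (edgeCut_mem ha hab hb)
  rw [primitive_sub_primitive hw hx hy]
  rcases le_total x y with hxy | hyx
  · exact (le_abs_self _).trans (hseg hx.1 hxy hy.2)
  · rw [intervalIntegral.integral_symm]
    exact (neg_le_abs _).trans (hseg hy.1 hyx hx.2)

theorem sum_primitive_len_eq_zero [Finite V] : ∑ e, primitive w e (Γ.len e) = 0 := by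
  have := Fintype.ofFinite V
  have hl (e : E) : Γ.len e ∈ Icc 0 (Γ.len e) := ⟨(Γ.len_pos e).le, le_rfl⟩
  have hmem := vertexCut_mem hl hl Finset.univ
  have h := hcut _ _ hmem
  rw [integralOn_segments_eq_sum_primitive hw (elementaryCuts_subset _ hmem)] at h
  simpa [vertexCut, boundaryCount, primitive_zero] using h

theorem minInflow_primitive_nonpos {lo hi : E → ℝ} (hlo : ∀ e, lo e ∈ Icc 0 (Γ.len e))
    (hhi : ∀ e, hi e ∈ Icc 0 (Γ.len e)) [DecidableEq V] (S : Finset V) :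
    minInflow Γ.init Γ.term (fun e => -1 - primitive w e (lo e))
      (fun e => 1 - primitive w e (hi e)) (fun e => primitive w e (Γ.len e)) S ≤ 0 := by
  have hmem := vertexCut_mem hlo hhi S
  have hvalue : minInflow Γ.init Γ.term (fun e => -1 - primitive w e (lo e))
      (fun e => 1 - primitive w e (hi e)) (fun e => primitive w e (Γ.len e)) S =
      integralOn (segments (Γ.vertexCut S lo hi)) w - Γ.boundaryCount (Sum.inl S) := by
    rw [integralOn_segments_eq_sum_primitive hw (elementaryCuts_subset _ hmem), boundaryCount,
      ← Finset.sum_sub_distrib]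
    refine Finset.sum_congr rfl fun e _ => ?_
    by_cases ht : Γ.term e ∈ S <;> by_cases hi : Γ.init e ∈ S <;>
      simp only [vertexCut, ht, hi, primitive_zero, if_true, if_false, iff_true, iff_false,
        not_true] <;> ring
  exact hvalue.trans_le (sub_nonpos.2 ((le_abs_self _).trans (hcut _ _ hmem)))

end

variable [Fintype E]

theorem exists_isKirchhoff [Finite V] {w : E → ℝ → ℝ}
    (hw : ∀ e, MemLp (w e) 2 (volume.restrict (Ioo 0 (Γ.len e))))
    (hcut : ∀ i, ∀ p ∈ Γ.elementaryCuts i, |integralOn (segments p) w| ≤ Γ.boundaryCount i) :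
    ∃ z, Γ.IsKirchhoff z w ∧ ∀ e, eLpNorm (z e) ∞ (volume.restrict (Ioo 0 (Γ.len e))) ≤ 1 := by
  classical
  have hwi (e : E) : IntegrableOn (w e) (Ioo 0 (Γ.len e)) := (hw e).integrable (by norm_num)
  have hne (e : E) : (Icc 0 (Γ.len e)).Nonempty := nonempty_Icc.2 (Γ.len_pos e).le
  choose lo hlo hmin using fun e =>
    isCompact_Icc.exists_isMinOn (hne e) (continuousOn_primitive_Icc (hwi e))
  choose hi hhi hmax using fun e =>
    isCompact_Icc.exists_isMaxOn (hne e) (continuousOn_primitive_Icc (hwi e))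
  obtain ⟨f, ⟨hfa, hfb⟩, hbal⟩ := exists_netInflow_eq_zero
    (fun e => by linarith [primitive_sub_primitive_le_two hwi hcut (hlo e) (hhi e)])
    (sum_primitive_len_eq_zero hwi hcut) (minInflow_primitive_nonpos hwi hcut hlo hhi)
  refine ⟨fun e x => f e + primitive w e x,
    ⟨fun e => isSobolev_primitive (Γ.len_pos e).le (hw e) (f e), fun v => ?_⟩, fun e => ?_⟩
  · rw [sum_outwardValue_eq_netInflow]
    simp only [primitive_zero, add_zero]
    exact hbal v
  · refine eLpNorm_exponent_top.trans_le (eLpNormEssSup_le_of_ae_enorm_bound ?_)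
    filter_upwards [ae_restrict_mem measurableSet_Ioo] with x hx
    have hx' := Ioo_subset_Icc_self hx
    have hlox : primitive w e (lo e) ≤ primitive w e x := hmin e hx'
    have hxhi : primitive w e x ≤ primitive w e (hi e) := hmax e hx'
    rw [Real.enorm_eq_ofReal_abs, ENNReal.ofReal_le_one]
    exact abs_le.2 ⟨by linarith [hfa e], by linarith [hfb e]⟩

end PrescribedDerivative

section SignSelection

/-- The function equal to `1` where `u` is positive, to `-1` where `u` is negative, and to `k`
elsewhere, a selection of the multivalued sign of `u` if `|k| ≤ 1`. -/
noncomputable def signSelection (Γ : CompactMetricGraph V E) (u : E → ℝ → ℝ) (k : ℝ) :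
    E → ℝ → ℝ :=
  fun e x => k + ((1 - k) * char (Γ.superlevel u 0) e x + -(1 + k) * char (Γ.sublevel u 0) e x)

theorem mul_signSelection {u : E → ℝ → ℝ} (k : ℝ) {e : E} {x : ℝ} (hx : x ∈ Ioo 0 (Γ.len e)) :
    u e x * Γ.signSelection u k e x = |u e x| := by
  rcases lt_trichotomy (u e x) 0 with h | h | h
  · simp [signSelection, char, superlevel, sublevel, h, h.not_gt, hx.1, hx.2, abs_of_neg h]
  · simp [h]
  · simp [signSelection, char, superlevel, sublevel, h, h.not_gt, hx.1, hx.2, abs_of_pos h]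

theorem abs_signSelection_le_one (u : E → ℝ → ℝ) {k : ℝ} (hk : |k| ≤ 1) (e : E) (x : ℝ) :
    |Γ.signSelection u k e x| ≤ 1 := by
  by_cases hsup : x ∈ Γ.superlevel u 0 e
  · have hsub : x ∉ Γ.sublevel u 0 e := fun h => lt_asymm hsup.2 h.2
    simp [signSelection, char, hsup, hsub]
  · by_cases hsub : x ∈ Γ.sublevel u 0 e <;> simp [signSelection, char, hsup, hsub, hk]

variable [Fintype E]

theorem IsMeasurableSubset.abs_integralOn_le_minorLength {D : E → Set ℝ}
    (hD : Γ.IsMeasurableSubset D) {s : E → ℝ → ℝ}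
    (hs : ∀ e, IntegrableOn (s e) (Ioo 0 (Γ.len e))) (hs1 : ∀ e x, |s e x| ≤ 1)
    (hmean : Γ.integral s = 0) : |integralOn D s| ≤ (Γ.minorLength D).toReal := by
  have hcompl : |integralOn D s| ≤ (length (Γ.compl D)).toReal := by
    have h := hD.compl.abs_integralOn_le hs1
    rwa [hD.integralOn_compl hs, hmean, zero_sub, abs_neg] at h
  rw [minorLength, ENNReal.toReal_min hD.length_ne_top hD.length_compl_ne_top]
  exact le_min (hD.abs_integralOn_le hs1) hcompl

theorem IsMedian.abs_length_sub_length_le {u : E → ℝ → ℝ} {m : ℝ} (hm : Γ.IsMedian u m) :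
    |(length (Γ.sublevel u m)).toReal - (length (Γ.superlevel u m)).toReal| ≤
      ∑ e, Γ.len e - (length (Γ.superlevel u m)).toReal - (length (Γ.sublevel u m)).toReal := by
  have hhalf {x : ℝ≥0∞} (hx : x ≤ Γ.totalLength / 2) : x.toReal ≤ (∑ e, Γ.len e) / 2 := by
    have h := ENNReal.toReal_mono (ENNReal.div_ne_top totalLength_ne_top two_ne_zero) hx
    rwa [ENNReal.toReal_div, toReal_totalLength, ENNReal.toReal_ofNat] at h
  have hsub := hhalf hm.1
  have hsup := hhalf hm.2
  exact abs_le.2 ⟨by linarith, by linarith⟩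

theorem exists_signSelection_integral_eq_zero {u : E → ℝ → ℝ}
    (hu : ∀ e, IntegrableOn (u e) (Ioo 0 (Γ.len e))) (hm : Γ.IsMedian u 0) :
    ∃ k, |k| ≤ 1 ∧ (∀ e, IntegrableOn (Γ.signSelection u k e) (Ioo 0 (Γ.len e))) ∧
      Γ.integral (Γ.signSelection u k) = 0 := by
  obtain ⟨k, hk, hkeq⟩ := exists_abs_le_one_mul_eq hm.abs_length_sub_length_le
  have hsup := isMeasurableSubset_superlevel hu 0
  have hsub := isMeasurableSubset_sublevel hu 0
  have hconst (e : E) : IntegrableOn (fun _ => k) (Ioo 0 (Γ.len e)) := integrableOn_const (by simp)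
  have hsupi (e : E) := (hsup.integrableOn_char e).const_mul (1 - k)
  have hsubi (e : E) := (hsub.integrableOn_char e).const_mul (-(1 + k))
  have hsumi (e : E) : IntegrableOn (fun x => (1 - k) * char (Γ.superlevel u 0) e x +
      -(1 + k) * char (Γ.sublevel u 0) e x) (Ioo 0 (Γ.len e)) := (hsupi e).add (hsubi e)
  refine ⟨k, hk, fun e => (hconst e).add (hsumi e), ?_⟩
  unfold signSelection
  rw [integral_add hconst hsumi, integral_add hsupi hsubi,
    integral_const, integral_const_mul, integral_const_mul, hsup.integral_char, hsub.integral_char]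
  linarith

theorem Admissible.ofReal_le_totalVariation [Finite V] {u : E → ℝ → ℝ} (hu : Γ.Admissible u)
    {c : ℝ} (hc : 0 ≤ c) (hcut : ∀ i, ∀ p ∈ Γ.elementaryCuts i,
      c * (Γ.minorLength (segments p)).toReal ≤ Γ.boundaryCount i) :
    ENNReal.ofReal c ≤ Γ.totalVariation u := by
  obtain ⟨k, hk, hs, hmean⟩ :=
    exists_signSelection_integral_eq_zero (fun e => (hu.memBV e).1) hu.median
  have hs1 := abs_signSelection_le_one (Γ := Γ) u hk
  obtain ⟨z, hz, hz1⟩ := exists_isKirchhoff (w := fun e x => c * Γ.signSelection u k e x)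
    (fun e => (MemLp.of_bound (hs e).aestronglyMeasurable 1
      (Filter.Eventually.of_forall (hs1 e))).const_mul c) fun i p hp => by
    have hD := (isFinitePerimeter_segments (elementaryCuts_subset i hp)).isMeasurableSubset
    simp only [integralOn, MeasureTheory.integral_const_mul, ← Finset.mul_sum]
    rw [abs_mul, abs_of_nonneg hc]
    exact (mul_le_mul_of_nonneg_left (hD.abs_integralOn_le_minorLength hs hs1 hmean) hc).trans
      (hcut i p hp)
  have hnorm : (Γ.integral fun e x => u e x * Γ.signSelection u k e x) = 1 := by
    rw [← hu.norm_eq_one]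
    exact Finset.sum_congr rfl fun e _ =>
      setIntegral_congr_fun measurableSet_Ioo fun x hx => mul_signSelection k hx
  simpa only [mul_left_comm _ c, integral_const_mul, hnorm, mul_one, abs_of_nonneg hc]
    using hz.le_totalVariation hz1 u

end SignSelection

/-! ### Cheeger cuts -/

section CheegerCuts

variable [Fintype E]

/-- The characteristic function of `D` divided by the length of `D`. -/
noncomputable def normalizedChar (D : E → Set ℝ) : E → ℝ → ℝ :=
  fun e x => (length D).toReal⁻¹ * char D e x

theorem totalVariation_normalizedChar {D : E → Set ℝ} (h0 : length D ≠ 0) (hfin : length D ≠ ⊤) :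
    Γ.totalVariation (normalizedChar D) = Γ.perimeter D / length D := by
  unfold normalizedChar
  rw [totalVariation_const_mul, abs_of_nonneg (by positivity),
    ENNReal.ofReal_inv_of_pos (ENNReal.toReal_pos h0 hfin), ENNReal.ofReal_toReal hfin, mul_comm,
    div_eq_mul_inv, perimeter]

theorem superlevel_normalizedChar {D : E → Set ℝ} (hD : Γ.IsMeasurableSubset D)
    (h0 : length D ≠ 0) : Γ.superlevel (normalizedChar D) 0 = D := by
  have hpos : 0 < (length D).toReal⁻¹ := inv_pos.2 (ENNReal.toReal_pos h0 hD.length_ne_top)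
  ext e x
  by_cases hx : x ∈ D e
  · simpa [superlevel, normalizedChar, char, hx, -inv_pos, hpos] using hD.subset e hx
  · simp [superlevel, normalizedChar, char, hx]

theorem normalizedChar_nonneg (D : E → Set ℝ) (e : E) (x : ℝ) : 0 ≤ normalizedChar D e x :=
  mul_nonneg (by positivity) (indicator_nonneg (fun _ _ => zero_le_one) x)

namespace IsFinitePerimeter

variable {D : E → Set ℝ}

theorem admissible_normalizedChar (hD : Γ.IsFinitePerimeter D) (h0 : length D ≠ 0)
    (hle : length D ≤ Γ.totalLength / 2) : Γ.Admissible (normalizedChar D) where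
  memBV e := (hD.memBV e).const_mul _
  norm_eq_one := by
    have hDm := hD.isMeasurableSubset
    simp only [abs_of_nonneg (normalizedChar_nonneg D _ _)]
    unfold normalizedChar
    rw [integral_const_mul, hDm.integral_char,
      inv_mul_cancel₀ (ENNReal.toReal_ne_zero.2 ⟨h0, hDm.length_ne_top⟩)]
  median := by
    refine ⟨?_, by rwa [superlevel_normalizedChar hD.isMeasurableSubset h0]⟩
    simp [sublevel, (normalizedChar_nonneg D _ _).not_gt, length]

theorem lambdaOne_le (hD : Γ.IsFinitePerimeter D) (h0 : length D ≠ 0)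
    (hle : length D ≤ Γ.totalLength / 2) : Γ.lambdaOne ≤ Γ.perimeter D / length D :=
  (iInf₂_le _ (hD.admissible_normalizedChar h0 hle)).trans_eq
    (totalVariation_normalizedChar h0 hD.isMeasurableSubset.length_ne_top)

theorem cheegerConstant_le (hD : Γ.IsFinitePerimeter D) (h0 : length D ≠ 0)
    (hle : length D ≤ Γ.totalLength / 2) : Γ.cheegerConstant ≤ Γ.perimeter D / length D := by
  have hDm := hD.isMeasurableSubset
  have hT0 : Γ.totalLength ≠ 0 := fun h => h0 (by simpa [h] using hle)
  have hlt : length D < Γ.totalLength :=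
    hle.trans_lt (ENNReal.half_lt_self hT0 totalLength_ne_top)
  have hmin : length D ≤ length (Γ.compl D) := by
    refine (ENNReal.add_le_add_iff_left hDm.length_ne_top).1 ?_
    rw [hDm.length_add_length_compl, ← ENNReal.add_halves Γ.totalLength]
    exact add_le_add hle hle
  refine iInf_le_of_le D (iInf₂_le_of_le hD (pos_iff_ne_zero.2 h0) (iInf_le_of_le hlt ?_))
  rw [min_eq_left hmin]

end IsFinitePerimeter

theorem lambdaOne_le_cheegerConstant [Finite V] : Γ.lambdaOne ≤ Γ.cheegerConstant := by
  refine le_iInf fun D => le_iInf₂ fun hD hpos => le_iInf fun hlt => ?_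
  have hDm := hD.isMeasurableSubset
  obtain ⟨D', hD', hlength, hperimeter⟩ := hD.exists_length_eq_minorLength
  have h := hD'.lambdaOne_le (hlength ▸ (lt_min hpos (hDm.length_compl_pos hlt)).ne')
    (hlength ▸ hDm.minorLength_le)
  rwa [hlength, hperimeter] at h

theorem exists_perimeter_div_length_le_lambdaOne [Finite V] [Nonempty E] :
    ∃ D, Γ.IsFinitePerimeter D ∧ length D ≠ 0 ∧ length D ≤ Γ.totalLength / 2 ∧
      Γ.perimeter D ≠ ⊤ ∧ Γ.perimeter D / length D ≤ Γ.lambdaOne := by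
  obtain ⟨i, p, hp, hpos, hopt⟩ := Γ.exists_optimal_elementaryCut
  have hfp := isFinitePerimeter_segments (elementaryCuts_subset i hp)
  have hper := perimeter_segments_le hp
  obtain ⟨hne0, hfin⟩ := ENNReal.toReal_pos_iff.1 hpos
  obtain ⟨D, hD, hlength, hperimeter⟩ := hfp.exists_length_eq_minorLength
  refine ⟨D, hD, hlength ▸ hne0.ne', hlength ▸ hfp.isMeasurableSubset.minorLength_le,
    hperimeter ▸ ne_top_of_le_ne_top ENNReal.ofReal_ne_top hper, le_iInf₂ fun u hu => ?_⟩
  calc Γ.perimeter D / length D ≤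
        ENNReal.ofReal (Γ.boundaryCount i) / Γ.minorLength (segments p) := by
        rw [hlength, hperimeter]
        exact ENNReal.div_le_div_right hper _
    _ = ENNReal.ofReal (Γ.boundaryCount i / (Γ.minorLength (segments p)).toReal) := by
        rw [ENNReal.ofReal_div_of_pos hpos, ENNReal.ofReal_toReal hfin.ne]
    _ ≤ Γ.totalVariation u :=
        hu.ofReal_le_totalVariation (div_nonneg (boundaryCount_nonneg i) hpos.le) hopt

end CheegerCuts

end CompactMetricGraph

theorem theorem4p1 {V E : Type*} [Fintype V] [Fintype E] [Nonempty E]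
    (Γ : CompactMetricGraph V E) :
    Γ.cheegerConstant = Γ.lambdaOne ∧ Γ.lambdaOne ≠ ⊤ ∧
      ∃ u : E → ℝ → ℝ, Γ.Admissible u ∧ Γ.totalVariation u = Γ.lambdaOne ∧
        ∃ t : ℝ, 0 ≤ t ∧ Γ.IsCheegerCut (Γ.superlevel u t) := by
  obtain ⟨D, hD, h0, hhalf, hper, hratio⟩ := Γ.exists_perimeter_div_length_le_lambdaOne
  have hlambda : Γ.perimeter D / CompactMetricGraph.length D = Γ.lambdaOne :=
    hratio.antisymm (hD.lambdaOne_le h0 hhalf)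
  have hcheeger : Γ.cheegerConstant = Γ.lambdaOne :=
    ((hD.cheegerConstant_le h0 hhalf).trans hratio).antisymm
      CompactMetricGraph.lambdaOne_le_cheegerConstant
  refine ⟨hcheeger, hlambda ▸ ENNReal.div_ne_top hper h0, CompactMetricGraph.normalizedChar D,
    hD.admissible_normalizedChar h0 hhalf, ?_, 0, le_rfl, ?_⟩
  · rw [CompactMetricGraph.totalVariation_normalizedChar h0 hD.isMeasurableSubset.length_ne_top,
      hlambda]
  · rw [CompactMetricGraph.superlevel_normalizedChar hD.isMeasurableSubset h0]
    exact ⟨hD, pos_iff_ne_zero.2 h0, hhalf, hcheeger.trans hlambda.symm⟩
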